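/- **Proposition 6.3.** Let $d\ge 1$ be an integer and $C\ge 1$. There exists a constant $C_9=C_9(d,C)$ such that the following holds for every real separable Hilbert space $H$ with $\dim(H)>d$ (possibly infinite). Let $\mu$ be a $d$-regular measure on $H$ with constant $C$, i.e. a locally finite Borel measure with $$C^{-1}t^d\le\mu(B(x,t))\le C\,t^d\qquad\text{for all }x\in\operatorname{supp}(\mu)\text{ and all real }0<t\le\operatorname{diam}(\operatorname{supp}(\mu)),$$ where $B(x,t)$ is the closed ball (in particular $C$ may be the regularity constant $C_\mu$ of $\mu$, the least such $C$). Then for every closed ball $B=B(z,r)\subseteq H$, $r>0$, with $\tfrac13 B=B(z,r/3)$, $$\widetilde J_{d+1}\left(\mu|_{\frac13 B}\right)\le C_9\cdot c_L^{d+1}(\mu|_B)$$ as an inequality in $[0,\infty]$. Here, for $1\le p<\infty$, $$\widetilde J_p(\mu|_{B})=\int_B\int_0^{\operatorname{diam}(B)}\beta_p^p(x,t)\,\frac{dt}{t}\,d\mu(x),\qquad \beta_p(x,t)=\inf_{L}\left(\int_{B(x,t)}\left(\frac{\operatorname{dist}(y,L)}{2t}\right)^p\frac{d\mu(y)}{\mu(B(x,t))}\right)^{1/p},$$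 the infimum being over all $d$-dimensional affine subspaces $L$ of $H$ (and $\beta_p(x,t)=0$ if $\mu(B(x,t))=0$), and $$c_L^{d+1}(\mu|_B)=\int_{B^{d+2}}c_L^{d+1}(X)\,d\mu^{d+2}(X),\qquad c_L^{d+1}(X)=\frac{\operatorname{dist}(x_0,L[X(0)])^{d+1}}{\prod_{i=1}^{d+1}\|x_i-x_0\|^{d+1}}$$ for $X=(x_0,\dots,x_{d+1})\in H^{d+2}$, where $L[X(0)]$ is the affine span of $x_1,\dots,x_{d+1}$ (and $c_L^{d+1}(X)=0$ if some $x_i=x_0$, $i\ge1$). -/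

import Mathlib

open MeasureTheory
open scoped ENNReal NNReal

noncomputable section

/-- `μ` is a `d`-regular (`d`-dimensional Ahlfors regular) measure with constant `C`: a locally
finite Borel measure with `C⁻¹ t^d ≤ μ (B(x, t)) ≤ C t^d` for all `x` in the support of `μ` and all
real `t` with `0 < t ≤ diam (supp μ)`, the diameter being possibly infinite.
The regularity constant of `μ` is the least such `C ≥ 1`. -/
structure IsAhlforsRegular {H : Type*} [PseudoMetricSpace H] [MeasurableSpace H] [BorelSpace H]
    (d : ℕ) (C : ℝ) (μ : Measure H) : Prop where
  isLocallyFinite : IsLocallyFiniteMeasure μ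
  one_le : 1 ≤ C
  le_measure : ∀ x ∈ μ.support, ∀ t : ℝ, 0 < t → ENNReal.ofReal t ≤ Metric.ediam μ.support →
    ENNReal.ofReal (C⁻¹ * t ^ d) ≤ μ (Metric.closedBall x t)
  measure_le : ∀ x ∈ μ.support, ∀ t : ℝ, 0 < t → ENNReal.ofReal t ≤ Metric.ediam μ.support →
    μ (Metric.closedBall x t) ≤ ENNReal.ofReal (C * t ^ d)

section Hilbert

variable {H : Type*} [NormedAddCommGroup H] [InnerProductSpace ℝ H]

/-- `L` is a `d`-plane: a (nonempty) affine subspace of dimension `d`. -/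
structure IsPlane (d : ℕ) (L : AffineSubspace ℝ H) : Prop where
  nonempty : (L : Set H).Nonempty
  rank_eq : Module.rank ℝ L.direction = (d : Cardinal)

open scoped Classical in
/-- The `d`-dimensional Jones number `β_p(x, t)` of `μ`, where `B(x, t)` is the closed ball. -/
def jonesBeta [MeasurableSpace H] (d : ℕ) (p : ℝ) (μ : Measure H) (x : H) (t : ℝ) : ℝ≥0∞ :=
  if μ (Metric.closedBall x t) = 0 then 0
  else ⨅ (L : AffineSubspace ℝ H) (_ : IsPlane d L),
    ((∫⁻ y in Metric.closedBall x t,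
        ENNReal.ofReal (Metric.infDist y (L : Set H) / (2 * t)) ^ p ∂μ)
      / μ (Metric.closedBall x t)) ^ (1 / p)

/-- The flatness `J̃_p(μ|_B) = ∫_B ∫_0^{diam B} β_p(x, t)^p dt/t dμ(x)`, with values in `[0, ∞]`. -/
def jonesFlatnessTilde [MeasurableSpace H] (d : ℕ) (p : ℝ) (μ : Measure H) (B : Set H) : ℝ≥0∞ :=
  ∫⁻ x in B, ∫⁻ t in Set.Ioc 0 (Metric.diam B),
    jonesBeta d p μ x t ^ p / ENNReal.ofReal t ∂volume ∂μ

/-- Léger's discrete curvature `c_L^{d+1}(X)` of the simplex `X = (x₀, …, x_{d+1})`: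
the distance from `x₀` to the affine span of `x₁, …, x_{d+1}`, to the power `d + 1`, divided by
`∏_{i=1}^{d+1} ‖x_i - x₀‖^{d+1}`. It is zero when some `x_i` equals `x₀`
(both the numerator and the denominator vanish there). -/
def legerCurvature {d : ℕ} (X : Fin (d + 2) → H) : ℝ :=
  Metric.infDist (X 0)
      (affineSpan ℝ (Set.range fun i : Fin (d + 1) => X i.succ) : Set H) ^ (d + 1)
    / ∏ i : Fin (d + 1), ‖X i.succ - X 0‖ ^ (d + 1)

/-- The continuous curvature `c_L^{d+1}(μ|_B) = ∫_{B^{d+2}} c_L^{d+1}(X) dμ^{d+2}(X)`,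
with values in `[0, ∞]`. -/
def legerCurvatureMeasure [MeasurableSpace H] (d : ℕ) (μ : Measure H) (B : Set H) : ℝ≥0∞ :=
  ∫⁻ X in Set.univ.pi (fun _ : Fin (d + 2) => B),
    ENNReal.ofReal (legerCurvature X) ∂(Measure.pi fun _ : Fin (d + 2) => μ)

end Hilbert

end

/-! Any `d + 1` points lie in some `d`-plane, with no general position needed, so every choice of
them gives a competitor for the Jones number, and averaging over choices bounds `β(x, t)^(d+1)`. If
all vertices lie within `s ≤ t` of `x`, the edges at `x₀` are at most `2s`, so the normalised
distance is controlled by the curvature. Drawing the face vertices from small balls around two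
separated support points, regularity gives `β(x, t)^(d+1) ≲ s^(-d) (s/t) ∫ c_L^(d+1)` over wide
simplices (`jonesBeta_rpow_le_lintegral`).

Here `s = min(t, diam supp μ)`, since regularity holds only up to the diameter. Integrate in `dμ(x)
dt/t` and swap (`jonesFlatnessTilde_le_legerCurvatureMeasure`). For a fixed simplex, the
`x`-integral gives `μ(B(x₀, s)) ≤ C s^d`, cancelling `s^(-d)`; what remains is `s/t² dt`. With `ρ =
‖x₁ - x_{d+1}‖`, wideness gives `s ≤ ρ/c`, while `ρ ≤ 2t`, so the scales contribute at most
`∫_{ρ/2}^∞ ρ/(c t²) dt = 2/c`, independently of the simplex. -/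

/-! ### Planes through given points -/

theorem Submodule.exists_le_finrank_eq {K V : Type*} [DivisionRing K] [AddCommGroup V] [Module K V]
    (W : Submodule K V) [FiniteDimensional K W] {n : ℕ} (hW : Module.finrank K W ≤ n)
    (hn : (n : Cardinal) ≤ Module.rank K V) :
    ∃ U : Submodule K V, W ≤ U ∧ Module.rank K U = n := by
  induction n, hW using Nat.le_induction with
  | base => exact ⟨W, le_rfl, (Module.finrank_eq_rank K W).symm⟩
  | succ n _ ih =>
    obtain ⟨U, hWU, hU⟩ := ih (le_trans (by exact_mod_cast n.le_succ) hn)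
    have hfin : Module.Finite K U := by
      rw [← Module.rank_lt_aleph0_iff, hU]; exact Cardinal.natCast_lt_aleph0
    have hne : U ≠ ⊤ := by
      rintro rfl
      rw [rank_top] at hU
      rw [hU] at hn
      exact absurd (Nat.cast_le.mp hn) (by omega)
    obtain ⟨v, -, hv⟩ := SetLike.exists_of_lt hne.lt_top
    refine ⟨U ⊔ K ∙ v, hWU.trans le_sup_left, ?_⟩
    have hv0 : v ≠ 0 := fun h => hv (h ▸ U.zero_mem)
    have h1 := Submodule.finrank_sup_add_finrank_inf_eq U (K ∙ v)
    have h2 : U ⊓ K ∙ v = ⊥ := by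
      rw [← disjoint_iff]
      exact (Submodule.disjoint_span_singleton' hv0).2 hv
    rw [h2, finrank_bot, finrank_span_singleton hv0, Module.finrank_eq_of_rank_eq hU] at h1
    rw [← Module.finrank_eq_rank, ← h1, add_zero]

section Hilbert

variable {H : Type*} [NormedAddCommGroup H] [InnerProductSpace ℝ H]

theorem exists_isPlane_affineSpan_range_le {d : ℕ} (hd : (d : Cardinal) ≤ Module.rank ℝ H)
    (x : Fin (d + 1) → H) :
    ∃ L : AffineSubspace ℝ H, IsPlane d L ∧ affineSpan ℝ (Set.range x) ≤ L := by
  have hfin := finiteDimensional_vectorSpan_range ℝ x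
  obtain ⟨U, hU, hrank⟩ := Submodule.exists_le_finrank_eq (vectorSpan ℝ (Set.range x))
    (finrank_vectorSpan_range_le ℝ x (n := d) (by simp)) hd
  refine ⟨AffineSubspace.mk' (x 0) U, ⟨⟨x 0, AffineSubspace.self_mem_mk' _ _⟩, ?_⟩, ?_⟩
  · rw [AffineSubspace.direction_mk', hrank]
  · rw [affineSpan_le]
    rintro _ ⟨i, rfl⟩
    exact hU (vsub_mem_vectorSpan ℝ (Set.mem_range_self i) (Set.mem_range_self 0))

/-! ### Measurability and pointwise bounds for the curvature -/

/-- The distance is an infimum, over weights of sum one, of functions continuous in the point and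
the vertices, so its strict sublevel sets are open. -/
theorem measurable_infDist_affineSpan_range {ι : Type*} [Fintype ι] [Nonempty ι]
    [SecondCountableTopology H] [MeasurableSpace H] [BorelSpace H] :
    Measurable fun X : H × (ι → H) =>
      Metric.infDist X.1 (affineSpan ℝ (Set.range X.2) : Set H) := by
  refine measurable_of_Iio fun a => IsOpen.measurableSet ?_
  have : (fun X : H × (ι → H) => Metric.infDist X.1 (affineSpan ℝ (Set.range X.2) : Set H)) ⁻¹'
      Set.Iio a = ⋃ w : {w : ι → ℝ // ∑ i, w i = 1},
        {X : H × (ι → H) | dist X.1 (∑ i, w.1 i • X.2 i) < a} := by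
    ext X
    have hne : (affineSpan ℝ (Set.range X.2) : Set H).Nonempty :=
      (affineSpan_nonempty ℝ).2 (Set.range_nonempty _)
    simp only [Set.mem_preimage, Set.mem_Iio, Set.mem_iUnion, Set.mem_ofPred_eq, Subtype.exists]
    rw [Metric.infDist_lt_iff hne]
    constructor
    · rintro ⟨y, hy, hya⟩
      obtain ⟨w, hw, rfl⟩ := eq_affineCombination_of_mem_affineSpan_of_fintype hy
      refine ⟨w, hw, ?_⟩
      rwa [Finset.univ.affineCombination_eq_linear_combination _ _ hw] at hya
    · rintro ⟨w, hw, hwa⟩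
      refine ⟨_, affineCombination_mem_affineSpan hw X.2, ?_⟩
      rwa [Finset.univ.affineCombination_eq_linear_combination _ _ hw]
  rw [this]
  exact isOpen_iUnion fun w => isOpen_lt (by fun_prop) continuous_const

theorem measurable_legerCurvature [SecondCountableTopology H] [MeasurableSpace H] [BorelSpace H]
    {d : ℕ} : Measurable (legerCurvature : (Fin (d + 2) → H) → ℝ) := by
  have h : Measurable fun X : Fin (d + 2) → H =>
      Metric.infDist (X 0) (affineSpan ℝ (Set.range fun i : Fin (d + 1) => X i.succ) : Set H) :=
    measurable_infDist_affineSpan_range.comp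
      (f := fun X : Fin (d + 2) → H => (X 0, fun i : Fin (d + 1) => X i.succ)) (by fun_prop)
  unfold legerCurvature
  fun_prop

theorem legerCurvature_nonneg {d : ℕ} (X : Fin (d + 2) → H) : 0 ≤ legerCurvature X :=
  div_nonneg (pow_nonneg Metric.infDist_nonneg _) (by positivity)

/-- When the product vanishes, `x₀` is a vertex of the opposite face and the distance vanishes too,
so division by zero does no harm. -/
theorem infDist_pow_le_legerCurvature_mul_prod {d : ℕ} (X : Fin (d + 2) → H) :
    Metric.infDist (X 0) (affineSpan ℝ (Set.range fun i : Fin (d + 1) => X i.succ) : Set H) ^ (d + 1)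
      ≤ legerCurvature X * ∏ i : Fin (d + 1), ‖X i.succ - X 0‖ ^ (d + 1) := by
  by_cases h : ∏ i : Fin (d + 1), ‖X i.succ - X 0‖ ^ (d + 1) = 0
  · obtain ⟨i, -, hi⟩ := Finset.prod_eq_zero_iff.1 h
    have hi' : X i.succ = X 0 := by
      rwa [pow_eq_zero_iff (by omega), norm_eq_zero, sub_eq_zero] at hi
    have hmem : X 0 ∈ (affineSpan ℝ (Set.range fun i : Fin (d + 1) => X i.succ) : Set H) :=
      hi' ▸ mem_affineSpan ℝ (Set.mem_range_self i)
    rw [Metric.infDist_zero_of_mem hmem, h]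
    simp
  · rw [legerCurvature, div_mul_cancel₀ _ h]

theorem infDist_div_pow_le_legerCurvature {d : ℕ} {x : H} {s t : ℝ} (hs : 0 < s) (hst : s ≤ t)
    {X : Fin (d + 2) → H} (hX : ∀ i, X i ∈ Metric.closedBall x s) :
    (Metric.infDist (X 0) (affineSpan ℝ (Set.range fun i : Fin (d + 1) => X i.succ) : Set H)
        / (2 * t)) ^ (d + 1) ≤ s / t * (2 * s) ^ (d * (d + 1)) * legerCurvature X := by
  have ht : 0 < t := hs.trans_le hst
  have hprod : ∏ i : Fin (d + 1), ‖X i.succ - X 0‖ ^ (d + 1) ≤ (2 * s) ^ ((d + 1) * (d + 1)) := by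
    calc ∏ i : Fin (d + 1), ‖X i.succ - X 0‖ ^ (d + 1)
        ≤ ∏ _i : Fin (d + 1), (2 * s) ^ (d + 1) := by
          refine Finset.prod_le_prod (fun i _ => by positivity) fun i _ => ?_
          refine pow_le_pow_left₀ (norm_nonneg _) ?_ _
          rw [← dist_eq_norm, two_mul]
          exact (dist_triangle_right _ _ x).trans (add_le_add (hX _) (hX _))
      _ = _ := by simp [← pow_mul]
  have h := (infDist_pow_le_legerCurvature_mul_prod X).trans
    (mul_le_mul_of_nonneg_left hprod (legerCurvature_nonneg X))
  -- One factor `s / t` is kept: it gives the decay in `t` beyond the diameter of the support.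
  have hratio : (s / t) ^ (d + 1) ≤ s / t := by
    rw [pow_succ]
    exact mul_le_of_le_one_left (by positivity)
      (pow_le_one₀ (by positivity) ((div_le_one ht).2 hst))
  have h0 := legerCurvature_nonneg X
  calc _ ≤ legerCurvature X * (2 * s) ^ ((d + 1) * (d + 1)) / (2 * t) ^ (d + 1) := by
        rw [div_pow]; gcongr
    _ = (s / t) ^ (d + 1) * (2 * s) ^ (d * (d + 1)) * legerCurvature X := by
        rw [add_mul, pow_add, one_mul, mul_pow 2 s (d + 1), mul_pow 2 t, div_pow]
        field_simp
    _ ≤ _ := by gcongr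

end Hilbert

theorem lintegral_pi_succ {H : Type*} [MeasurableSpace H] {d : ℕ} (μ : Measure H) [SigmaFinite μ]
    {f : (Fin (d + 2) → H) → ℝ≥0∞} (hf : Measurable f) :
    ∫⁻ X, f X ∂(Measure.pi fun _ => μ) =
      ∫⁻ X' : Fin (d + 1) → H, ∫⁻ y, f (Fin.cons y X') ∂μ ∂(Measure.pi fun _ => μ) := by
  have h := (measurePreserving_piFinSuccAbove (fun _ : Fin (d + 2) => μ) 0).symm
  rw [← h.lintegral_comp hf]
  refine (lintegral_prod_symm' _ (hf.comp h.measurable)).trans ?_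
  simp [MeasurableEquiv.piFinSuccAbove, Fin.insertNthEquiv]

/-! ### Simplices with a long edge -/

section Metric

variable {H : Type*} [PseudoMetricSpace H] [SecondCountableTopology H] [MeasurableSpace H]
  [BorelSpace H]

/-- The simplices whose vertices lie in `closedBall x s` and whose first face is not too short. -/
def wideSimplices (d : ℕ) (c : ℝ) (x : H) (s : ℝ) : Set (Fin (d + 2) → H) :=
  {X | (∀ i, X i ∈ Metric.closedBall x s) ∧
    c * s ≤ dist (X (Fin.succ 0)) (X (Fin.succ (Fin.last d)))}

theorem measurableSet_wideSimplices (d : ℕ) (c : ℝ) (x : H) (s : ℝ) :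
    MeasurableSet (wideSimplices d c x s) := by
  refine IsClosed.measurableSet ?_
  simp only [wideSimplices, Set.ofPred_and, Set.ofPred_forall]
  refine IsClosed.inter (isClosed_iInter fun i => ?_) ?_
  · exact Metric.isClosed_closedBall.preimage (continuous_apply i)
  · exact isClosed_le continuous_const (by fun_prop)

/-- Otherwise the ball of radius `3cs` carries all the mass of the ball of radius `s/2`, too much
for the upper regularity bound. -/
theorem IsAhlforsRegular.exists_mem_support_lt_dist {d : ℕ} (hd : 1 ≤ d) {C : ℝ} {μ : Measure H}
    (hμ : IsAhlforsRegular d C μ) {x : H} (hx : x ∈ μ.support) {s : ℝ} (hs : 0 < s)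
    (hsD : ENNReal.ofReal s ≤ Metric.ediam μ.support) {c : ℝ} (hc0 : 0 < c)
    (hc : 12 * C ^ 2 * c ≤ 1) :
    ∃ b ∈ μ.support, dist b x ≤ s / 2 ∧ 3 * (c * s) < dist b x := by
  by_contra! hcon
  have hC := hμ.one_le
  have hc1 : 12 * c ≤ 1 := by nlinarith [one_le_pow₀ hC (n := 2)]
  have hle : ∀ u ≤ s, ENNReal.ofReal u ≤ Metric.ediam μ.support := fun u hu =>
    (ENNReal.ofReal_le_ofReal hu).trans hsD
  have hsub : μ (Metric.closedBall x (s / 2)) ≤ μ (Metric.closedBall x (3 * (c * s))) := by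
    refine measure_mono_ae ?_
    filter_upwards [Measure.support_mem_ae (μ := μ)] with b hb hbx
    exact hcon b hb hbx
  have h1 := (hμ.le_measure x hx (s / 2) (by positivity) (hle _ (by linarith))).trans
    (hsub.trans (hμ.measure_le x hx (3 * (c * s)) (by positivity) (hle _ (by nlinarith))))
  rw [ENNReal.ofReal_le_ofReal_iff (by positivity)] at h1
  -- Contradictory, as `C² (6c)^d ≤ 6 C² c ≤ 1/2`.
  have h2 : (1 : ℝ) ≤ C ^ 2 * (6 * c) ^ d := by
    have e : C * (3 * (c * s)) ^ d = C * (6 * c) ^ d * (s / 2) ^ d := by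
      rw [mul_assoc, ← mul_pow]; ring_nf
    rw [e] at h1
    have h3 := le_of_mul_le_mul_right h1 (by positivity : 0 < (s / 2) ^ d)
    rw [inv_le_iff_one_le_mul₀ (by positivity)] at h3
    linarith [h3, sq C]
  have h4 : (6 * c) ^ d ≤ 6 * c := pow_le_of_le_one (by positivity) (by linarith) (by omega)
  nlinarith [sq_nonneg C, mul_le_mul_of_nonneg_left h4 (sq_nonneg C)]

end Metric

/-! ### The Jones number at a single scale -/

section Hilbert

variable {H : Type*} [NormedAddCommGroup H] [InnerProductSpace ℝ H]

theorem jonesBeta_rpow_mul_le [MeasurableSpace H] {d : ℕ} (hd : (d : Cardinal) ≤ Module.rank ℝ H)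
    {p : ℝ} (hp : 0 < p) (μ : Measure H) (x : H) {t : ℝ} (ht : 0 < t)
    (hfin : μ (Metric.closedBall x t) ≠ ∞) (X : Fin (d + 1) → H) :
    jonesBeta d p μ x t ^ p * μ (Metric.closedBall x t) ≤
      ∫⁻ y in Metric.closedBall x t,
        ENNReal.ofReal (Metric.infDist y (affineSpan ℝ (Set.range X) : Set H) / (2 * t)) ^ p ∂μ := by
  by_cases h0 : μ (Metric.closedBall x t) = 0
  · simp [h0]
  obtain ⟨L, hL, hXL⟩ := exists_isPlane_affineSpan_range_le hd X
  rw [← ENNReal.le_div_iff_mul_le (Or.inl h0) (Or.inl hfin), jonesBeta, if_neg h0]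
  calc _ ≤ (((∫⁻ y in Metric.closedBall x t,
        ENNReal.ofReal (Metric.infDist y (L : Set H) / (2 * t)) ^ p ∂μ)
          / μ (Metric.closedBall x t)) ^ (1 / p)) ^ p := by
        gcongr
        exact iInf₂_le L hL
    _ = (∫⁻ y in Metric.closedBall x t,
        ENNReal.ofReal (Metric.infDist y (L : Set H) / (2 * t)) ^ p ∂μ)
          / μ (Metric.closedBall x t) := by
        rw [← ENNReal.rpow_mul, one_div_mul_cancel hp.ne', ENNReal.rpow_one]
    _ ≤ _ := by
        gcongr with y
        exact Metric.infDist_le_infDist_of_subset hXL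
          ((affineSpan_nonempty ℝ).2 (Set.range_nonempty _))

variable [SecondCountableTopology H] [MeasurableSpace H] [BorelSpace H]

theorem lintegral_infDist_rpow_le {d : ℕ} {μ : Measure H} {x : H} {s t : ℝ} (hs : 0 < s) (hst : s ≤ t)
    (hsupp : μ.support ∩ Metric.closedBall x t ⊆ Metric.closedBall x s)
    {X : Fin (d + 1) → H} (hX : ∀ i, X i ∈ Metric.closedBall x s) :
    ∫⁻ y in Metric.closedBall x t, ENNReal.ofReal
        (Metric.infDist y (affineSpan ℝ (Set.range X) : Set H) / (2 * t)) ^ ((d : ℝ) + 1) ∂μ ≤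
      ENNReal.ofReal (s / t * (2 * s) ^ (d * (d + 1))) *
        ∫⁻ y in Metric.closedBall x s, ENNReal.ofReal (legerCurvature (Fin.cons y X)) ∂μ := by
  have ht := hs.trans_le hst
  rw [← lintegral_const_mul' _ _ ENNReal.ofReal_ne_top]
  have hAB : (Metric.closedBall x t : Set H) ≤ᵐ[μ] Metric.closedBall x s := by
    filter_upwards [Measure.support_mem_ae (μ := μ)] with b hb hbx
    exact hsupp ⟨hb, hbx⟩
  refine (lintegral_mono' (Measure.restrict_mono_ae hAB) le_rfl).trans ?_
  refine setLIntegral_mono' Metric.isClosed_closedBall.measurableSet fun y hy => ?_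
  rw [← ENNReal.ofReal_mul (by positivity)]
  have e : ((d : ℝ) + 1) = ((d + 1 : ℕ) : ℝ) := by push_cast; rfl
  rw [e, ENNReal.rpow_natCast,
    ← ENNReal.ofReal_pow (div_nonneg Metric.infDist_nonneg (by positivity))]
  refine ENNReal.ofReal_le_ofReal ?_
  have := infDist_div_pow_le_legerCurvature hs hst (X := Fin.cons y X) (x := x)
    (Fin.cases (by simpa using hy) (by simpa using hX))
  simpa using this

theorem jonesBeta_rpow_le_lintegral {d : ℕ} (hd : 1 ≤ d) (hrank : (d : Cardinal) ≤ Module.rank ℝ H)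
    {C : ℝ} {μ : Measure H}
    (hμ : IsAhlforsRegular d C μ) {x : H} (hx : x ∈ μ.support) {s t : ℝ} (hs : 0 < s) (hst : s ≤ t)
    (hsD : ENNReal.ofReal s ≤ Metric.ediam μ.support)
    (hsupp : μ.support ∩ Metric.closedBall x t ⊆ Metric.closedBall x s)
    {c : ℝ} (hc0 : 0 < c) (hc : 12 * C ^ 2 * c ≤ 1) :
    jonesBeta d ((d : ℝ) + 1) μ x t ^ ((d : ℝ) + 1) ≤
      ENNReal.ofReal (C ^ (d + 2) * (2 / c) ^ (d * (d + 1)) * (s ^ d)⁻¹ * (s / t)) *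
        ∫⁻ X in wideSimplices d c x s, ENNReal.ofReal (legerCurvature X)
          ∂(Measure.pi fun _ : Fin (d + 2) => μ) := by
  have := hμ.isLocallyFinite
  have ht := hs.trans_le hst
  have hC := hμ.one_le
  have hc1 : 12 * c ≤ 1 := by nlinarith [one_le_pow₀ hC (n := 2)]
  have hcs : c * s ≤ s / 12 := by nlinarith
  obtain ⟨b, hb, hbx, hbx'⟩ := hμ.exists_mem_support_lt_dist hd hx hs hsD hc0 hc
  set β := jonesBeta d ((d : ℝ) + 1) μ x t ^ ((d : ℝ) + 1)
  have hball : μ (Metric.closedBall x t) = μ (Metric.closedBall x s) := by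
    refine le_antisymm (measure_mono_ae ?_)
      (measure_mono (Metric.closedBall_subset_closedBall hst))
    filter_upwards [Measure.support_mem_ae (μ := μ)] with b hb hbx
    exact hsupp ⟨hb, hbx⟩
  have hfin : μ (Metric.closedBall x t) ≠ ∞ := by
    rw [hball]
    exact ne_top_of_le_ne_top ENNReal.ofReal_ne_top (hμ.measure_le x hx s hs hsD)
  -- a product of small balls whose simplices are all wide
  let a : Fin (d + 1) → H := fun i => if i = 0 then b else x
  let S : Set (Fin (d + 1) → H) := Set.univ.pi fun i => Metric.closedBall (a i) (c * s)
  have ha : ∀ i, a i ∈ μ.support ∧ dist (a i) x ≤ s / 2 := fun i => by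
    by_cases h : i = 0 <;> simp [a, h, hb, hbx, hx]; positivity
  have hS : MeasurableSet S :=
    MeasurableSet.univ_pi fun i => Metric.isClosed_closedBall.measurableSet
  have hSball : ∀ X ∈ S, ∀ i, X i ∈ Metric.closedBall x s := fun X hX i => by
    have h1 : dist (X i) (a i) ≤ c * s := hX i (Set.mem_univ i)
    have h2 := dist_triangle (X i) (a i) x
    have h3 := (ha i).2
    simp only [Metric.mem_closedBall]
    linarith
  -- The centres `b` and `x` are more than `3cs` apart and each vertex is within `cs` of its centre;
  -- the two indices differ because `1 ≤ d`.
  have hSwide : ∀ X ∈ S, c * s ≤ dist (X 0) (X (Fin.last d)) := fun X hX => by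
    have h1 : dist (X 0) b ≤ c * s := by simpa [a] using hX 0 (Set.mem_univ _)
    have hne : Fin.last d ≠ 0 := by
      rw [Ne, Fin.ext_iff]; simp; omega
    have h2 : dist (X (Fin.last d)) x ≤ c * s := by
      simpa [a, hne] using hX (Fin.last d) (Set.mem_univ _)
    have h3 := dist_triangle4 b (X 0) (X (Fin.last d)) x
    rw [dist_comm b (X 0)] at h3
    linarith
  have hμS : ENNReal.ofReal ((C⁻¹ * (c * s) ^ d) ^ (d + 1)) ≤
      (Measure.pi fun _ : Fin (d + 1) => μ) S := by
    rw [Measure.pi_pi, ENNReal.ofReal_pow (by positivity)]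
    calc _ = ∏ _i : Fin (d + 1), ENNReal.ofReal (C⁻¹ * (c * s) ^ d) := by simp
      _ ≤ _ := Finset.prod_le_prod' fun i _ => hμ.le_measure _ (ha i).1 _ (by positivity)
          ((ENNReal.ofReal_le_ofReal (by linarith)).trans hsD)
  have hmeas : Measurable ((wideSimplices d c x s).indicator
      fun X : Fin (d + 2) → H => ENNReal.ofReal (legerCurvature X)) :=
    measurable_legerCurvature.ennreal_ofReal.indicator (measurableSet_wideSimplices d c x s)
  set I := ∫⁻ X in wideSimplices d c x s, ENNReal.ofReal (legerCurvature X)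
          ∂(Measure.pi fun _ : Fin (d + 2) => μ) with hI
  -- The `d + 2` lower mass bounds produce `C ^ (d + 2)`; the ball of radius `s` accounts for `s ^
  -- (-d)`, and the small balls against the edge lengths for the power of `2 / c`.
  have key : β * ENNReal.ofReal (C⁻¹ * s ^ d) * ENNReal.ofReal ((C⁻¹ * (c * s) ^ d) ^ (d + 1)) ≤
      ENNReal.ofReal (s / t * (2 * s) ^ (d * (d + 1))) * I := by
    calc β * ENNReal.ofReal (C⁻¹ * s ^ d) * ENNReal.ofReal ((C⁻¹ * (c * s) ^ d) ^ (d + 1))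
        ≤ β * μ (Metric.closedBall x t) * (Measure.pi fun _ : Fin (d + 1) => μ) S := by
          rw [hball]
          gcongr
          exact hμ.le_measure x hx s hs hsD
      _ = ∫⁻ _ in S, β * μ (Metric.closedBall x t) ∂(Measure.pi fun _ : Fin (d + 1) => μ) := by
          rw [setLIntegral_const]
      _ ≤ ∫⁻ X in S, ENNReal.ofReal (s / t * (2 * s) ^ (d * (d + 1))) *
            ∫⁻ y in Metric.closedBall x s, ENNReal.ofReal (legerCurvature (Fin.cons y X)) ∂μ
            ∂(Measure.pi fun _ : Fin (d + 1) => μ) :=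
          setLIntegral_mono' hS fun X hX =>
            (jonesBeta_rpow_mul_le hrank (by positivity) μ x ht hfin X).trans
              (lintegral_infDist_rpow_le hs hst hsupp (hSball X hX))
      _ = ENNReal.ofReal (s / t * (2 * s) ^ (d * (d + 1))) * ∫⁻ X in S,
            ∫⁻ y in Metric.closedBall x s, ENNReal.ofReal (legerCurvature (Fin.cons y X)) ∂μ
            ∂(Measure.pi fun _ : Fin (d + 1) => μ) :=
          lintegral_const_mul' _ _ ENNReal.ofReal_ne_top
      _ ≤ ENNReal.ofReal (s / t * (2 * s) ^ (d * (d + 1))) * I := by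
          gcongr
          rw [hI, ← lintegral_indicator (measurableSet_wideSimplices d c x s),
            lintegral_pi_succ μ hmeas]
          refine (setLIntegral_mono' hS fun X hX => ?_).trans (setLIntegral_le_lintegral S _)
          refine (setLIntegral_mono' Metric.isClosed_closedBall.measurableSet fun y hy => ?_).trans
            (setLIntegral_le_lintegral (Metric.closedBall x s) _)
          rw [Set.indicator_of_mem]
          refine ⟨Fin.cases (by simpa using hy) (by simpa using hSball X hX), ?_⟩
          simpa only [Fin.cons_succ] using hSwide X hX
  have hm : 0 < C⁻¹ * s ^ d * (C⁻¹ * (c * s) ^ d) ^ (d + 1) := by positivity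
  rw [mul_assoc, ← ENNReal.ofReal_mul (by positivity)] at key
  rw [← ENNReal.mul_le_mul_iff_left (c := ENNReal.ofReal
    (C⁻¹ * s ^ d * (C⁻¹ * (c * s) ^ d) ^ (d + 1))) (by simpa using hm) ENNReal.ofReal_ne_top]
  refine key.trans_eq ?_
  rw [mul_right_comm, ← ENNReal.ofReal_mul (by positivity)]
  congr 2
  have hC0 : C ≠ 0 := by positivity
  simp only [mul_pow, div_pow, inv_pow, ← pow_mul, pow_succ C]
  field_simp

end Hilbert

/-! ### Scales: the integral in `t` and truncation at the diameter -/

theorem lintegral_Ioi_inv_sq_le {ρ c : ℝ} (hρ : 0 ≤ ρ) (hc : 0 < c) :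
    ∫⁻ t in Set.Ioi (0 : ℝ), {t : ℝ | ρ ≤ 2 * t}.indicator
      (fun t => ENNReal.ofReal (ρ / (c * t ^ 2))) t ≤ ENNReal.ofReal (2 / c) := by
  rcases hρ.eq_or_lt with rfl | hρ
  · simp
  have hset : {t : ℝ | ρ ≤ 2 * t} = Set.Ici (ρ / 2) := by
    ext t; simp only [Set.mem_ofPred_eq, Set.mem_Ici]; constructor <;> intro h <;> linarith
  have hint : IntegrableOn (fun t : ℝ => t ^ (-2 : ℝ)) (Set.Ioi (ρ / 2)) :=
    integrableOn_Ioi_rpow_of_lt (by norm_num) (by positivity)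
  calc _ ≤ ∫⁻ t : ℝ, {t : ℝ | ρ ≤ 2 * t}.indicator
            (fun t => ENNReal.ofReal (ρ / (c * t ^ 2))) t := setLIntegral_le_lintegral _ _
    _ = ∫⁻ t in Set.Ioi (ρ / 2), ENNReal.ofReal (ρ / (c * t ^ 2)) := by
        rw [hset, lintegral_indicator measurableSet_Ici, restrict_Ioi_eq_restrict_Ici]
    _ = ∫⁻ t in Set.Ioi (ρ / 2), ENNReal.ofReal (ρ / c * t ^ (-2 : ℝ)) := by
        refine setLIntegral_congr_fun measurableSet_Ioi fun t ht => ?_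
        have ht0 : 0 < t := (half_pos hρ).trans ht
        rw [Real.rpow_neg ht0.le, Real.rpow_two]
        congr 1
        field_simp
    _ = ENNReal.ofReal (∫ t in Set.Ioi (ρ / 2), ρ / c * t ^ (-2 : ℝ)) := by
        refine (ofReal_integral_eq_lintegral_ofReal (hint.const_mul _) ?_).symm
        refine (ae_restrict_iff' measurableSet_Ioi).2 (ae_of_all _ fun t ht => ?_)
        have ht0 : 0 < t := (half_pos hρ).trans ht
        simp only [Pi.zero_apply]
        positivity
    _ = ENNReal.ofReal (2 / c) := by
        rw [integral_const_mul, integral_Ioi_rpow_of_lt (by norm_num) (by positivity)]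
        congr 1
        rw [show (-2 : ℝ) + 1 = -1 by norm_num, Real.rpow_neg_one]
        field_simp

theorem exists_truncated_radius {H : Type*} [PseudoMetricSpace H] {S : Set H}
    (hS : Metric.ediam S ≠ 0) :
    ∃ T : ℝ → ℝ, Measurable T ∧ ∀ t, 0 < t → 0 < T t ∧ T t ≤ t ∧
      ENNReal.ofReal (T t) ≤ Metric.ediam S ∧
      ∀ x ∈ S, S ∩ Metric.closedBall x t ⊆ Metric.closedBall x (T t) := by
  refine ⟨fun t => (min (ENNReal.ofReal t) (Metric.ediam S)).toReal, by fun_prop, fun t ht => ?_⟩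
  have hne : min (ENNReal.ofReal t) (Metric.ediam S) ≠ ∞ :=
    ne_top_of_le_ne_top ENNReal.ofReal_ne_top (min_le_left _ _)
  refine ⟨ENNReal.toReal_pos ?_ hne, ENNReal.toReal_le_of_le_ofReal ht.le (min_le_left _ _), ?_, ?_⟩
  · exact (lt_min (by simpa using ht) (pos_iff_ne_zero.2 hS)).ne'
  · rw [ENNReal.ofReal_toReal hne]
    exact min_le_right _ _
  · rintro x hx y ⟨hy, hyt⟩
    rw [Metric.mem_closedBall, ← ENNReal.ofReal_le_iff_le_toReal hne, ← edist_dist]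
    refine le_min ?_ (Metric.edist_le_ediam_of_mem hy hx)
    rw [edist_dist]
    exact ENNReal.ofReal_le_ofReal hyt

/-! ### Integration over points, scales and simplices -/

section Hilbert

variable {H : Type*} [NormedAddCommGroup H] [InnerProductSpace ℝ H]
  [SecondCountableTopology H] [MeasurableSpace H]

theorem jonesBeta_rpow_eq_zero_of_ediam_support_eq_zero {d : ℕ}
    (hrank : (d : Cardinal) ≤ Module.rank ℝ H) {p : ℝ} (hp : 0 < p) {μ : Measure H}
    [IsLocallyFiniteMeasure μ] (hμ : Metric.ediam μ.support = 0) {x : H} (hx : x ∈ μ.support)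
    {t : ℝ} (ht : 0 < t) : jonesBeta d p μ x t ^ p = 0 := by
  have hae : ∀ᵐ y ∂μ, y = x := by
    filter_upwards [Measure.support_mem_ae (μ := μ)] with y hy
    rw [← edist_eq_zero, ← nonpos_iff_eq_zero, ← hμ]
    exact Metric.edist_le_ediam_of_mem hy hx
  have hfin : μ (Metric.closedBall x t) ≠ ∞ := by
    -- Regularity is vacuous here, so finiteness comes from local finiteness at the only support
    -- point.
    refine ne_top_of_le_ne_top (isCompact_singleton (x := x)).measure_lt_top.ne (measure_mono_ae ?_)
    filter_upwards [hae] with y hy _ using hy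
  have h0 : μ (Metric.closedBall x t) ≠ 0 :=
    ((Measure.mem_support_iff_forall x).1 hx _ (Metric.closedBall_mem_nhds x ht)).ne'
  have h := jonesBeta_rpow_mul_le hrank hp μ x ht hfin fun _ => x
  have hzero : ∫⁻ y in Metric.closedBall x t, ENNReal.ofReal (Metric.infDist y
      (affineSpan ℝ (Set.range fun _ : Fin (d + 1) => x) : Set H) / (2 * t)) ^ p ∂μ = 0 := by
    rw [← nonpos_iff_eq_zero, ← lintegral_zero (μ := μ.restrict (Metric.closedBall x t))]
    refine lintegral_mono_ae ?_
    filter_upwards [ae_restrict_of_ae hae] with y hy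
    subst hy
    have hmem : y ∈ (affineSpan ℝ (Set.range fun _ : Fin (d + 1) => y) : Set H) :=
      mem_affineSpan ℝ ⟨0, rfl⟩
    rw [Metric.infDist_zero_of_mem hmem]
    simp [hp]
  rw [hzero, nonpos_iff_eq_zero, mul_eq_zero] at h
  exact h.resolve_right h0

variable [BorelSpace H]

theorem jonesFlatnessTilde_le_lintegral {d : ℕ} {p : ℝ} {μ : Measure H} {z : H} {r : ℝ} (hr : 0 ≤ r)
    {F : H → ℝ → ℝ≥0∞}
    (hF : ∀ x ∈ μ.support, x ∈ Metric.closedBall z (r / 3) → ∀ t, 0 < t → t ≤ 2 * (r / 3) →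
      jonesBeta d p μ x t ^ p / ENNReal.ofReal t ≤ F x t) :
    jonesFlatnessTilde d p μ (Metric.closedBall z (r / 3)) ≤
      ∫⁻ x, ∫⁻ t in Set.Ioi (0 : ℝ), F x t ∂volume ∂μ := by
  refine le_trans (lintegral_mono_ae ?_) (setLIntegral_le_lintegral (Metric.closedBall z (r / 3)) _)
  rw [ae_restrict_iff' Metric.isClosed_closedBall.measurableSet]
  filter_upwards [Measure.support_mem_ae (μ := μ)] with x hx hxz
  refine (setLIntegral_mono' measurableSet_Ioc fun t ht => hF x hx hxz t ht.1 (ht.2.trans ?_)).trans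
    (lintegral_mono_set Set.Ioc_subset_Ioi_self)
  exact Metric.diam_closedBall (by positivity)

theorem jonesFlatnessTilde_le_legerCurvatureMeasure {d : ℕ} (hd : 1 ≤ d)
    (hrank : (d : Cardinal) ≤ Module.rank ℝ H) {C : ℝ} {μ : Measure H}
    (hμ : IsAhlforsRegular d C μ) (z : H) {r : ℝ} (hr : 0 < r) {c : ℝ} (hc0 : 0 < c)
    (hc : 12 * C ^ 2 * c ≤ 1) :
    jonesFlatnessTilde d ((d : ℝ) + 1) μ (Metric.closedBall z (r / 3)) ≤
      ENNReal.ofReal (C ^ (d + 2) * (2 / c) ^ (d * (d + 1)) * C * (2 / c)) *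
        legerCurvatureMeasure d μ (Metric.closedBall z r) := by
  have := hμ.isLocallyFinite
  have hC := hμ.one_le
  by_cases hD : Metric.ediam μ.support = 0
  · refine (jonesFlatnessTilde_le_lintegral hr.le (F := fun _ _ => 0) ?_).trans (by simp)
    intro x hx _ t ht _
    rw [jonesBeta_rpow_eq_zero_of_ediam_support_eq_zero hrank (by positivity) hD hx ht,
      ENNReal.zero_div]
  obtain ⟨T, hTm, hT⟩ := exists_truncated_radius hD
  set K : ℝ := C ^ (d + 2) * (2 / c) ^ (d * (d + 1))
  have hK0 : 0 < K := by positivity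
  set ρ : (Fin (d + 2) → H) → ℝ := fun X => dist (X (Fin.succ 0)) (X (Fin.succ (Fin.last d)))
  have hρm : Measurable ρ := by fun_prop
  set E : Set (Fin (d + 2) → H) := Set.univ.pi fun _ => Metric.closedBall z r
  let ν : Measure (Fin (d + 2) → H) := (Measure.pi fun _ : Fin (d + 2) => μ).restrict E
  -- Only `u` depends on `x`, and `w` carries the remaining dependence on `t`, so the two integrals
  -- can be done in turn.
  let u : H → ℝ → (Fin (d + 2) → H) → ℝ≥0∞ := fun x t X =>
    {q : H × ℝ × (Fin (d + 2) → H) | dist q.1 (q.2.2 0) ≤ T q.2.1}.indicator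
      (fun q => ENNReal.ofReal (K * (T q.2.1 ^ d)⁻¹)) (x, t, X)
  let w : ℝ → (Fin (d + 2) → H) → ℝ≥0∞ := fun t X =>
    {q : ℝ × (Fin (d + 2) → H) | ρ q.2 ≤ 2 * q.1}.indicator
      (fun q => ENNReal.ofReal (ρ q.2 / (c * q.1 ^ 2))) (t, X)
  let ℓ : (Fin (d + 2) → H) → ℝ≥0∞ := fun X => ENNReal.ofReal (legerCurvature X)
  have hu : Measurable fun q : H × ℝ × (Fin (d + 2) → H) => u q.1 q.2.1 q.2.2 :=
    Measurable.indicator (by fun_prop) (measurableSet_le (by fun_prop) (by fun_prop))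
  have hw : Measurable fun q : ℝ × (Fin (d + 2) → H) => w q.1 q.2 :=
    Measurable.indicator (by fun_prop) (measurableSet_le (by fun_prop) (by fun_prop))
  have hℓ : Measurable ℓ := measurable_legerCurvature.ennreal_ofReal
  have hF : Measurable fun q : H × ℝ × (Fin (d + 2) → H) =>
      u q.1 q.2.1 q.2.2 * (w q.2.1 q.2.2 * ℓ q.2.2) :=
    hu.mul ((hw.comp measurable_snd).mul (hℓ.comp (measurable_snd.comp measurable_snd)))
  have hpoint : ∀ x ∈ μ.support, x ∈ Metric.closedBall z (r / 3) → ∀ t, 0 < t → t ≤ 2 * (r / 3) →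
      jonesBeta d ((d : ℝ) + 1) μ x t ^ ((d : ℝ) + 1) / ENNReal.ofReal t ≤
        ∫⁻ X, u x t X * (w t X * ℓ X) ∂ν := by
    intro x hx hxz t ht htr
    obtain ⟨hT0, hTt, hTD, hTs⟩ := hT t ht
    -- This is where the factor `1/3` is used: `r/3 + T t ≤ r/3 + 2r/3 = r`.
    have hsub : wideSimplices d c x (T t) ⊆ E := by
      intro X hX i _
      have h1 := hX.1 i
      simp only [Metric.mem_closedBall] at h1 hxz ⊢
      linarith [dist_triangle (X i) x z]
    have hWm := measurableSet_wideSimplices d c x (T t)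
    rw [div_eq_mul_inv, ← ENNReal.ofReal_inv_of_pos ht]
    calc _ ≤ ENNReal.ofReal (K * (T t ^ d)⁻¹ * (T t / t)) *
        (∫⁻ X in wideSimplices d c x (T t), ℓ X ∂(Measure.pi fun _ : Fin (d + 2) => μ))
          * ENNReal.ofReal t⁻¹ := by
          gcongr
          exact jonesBeta_rpow_le_lintegral hd hrank hμ hx hT0 hTt hTD (hTs x hx) hc0 hc
      _ = ∫⁻ X in wideSimplices d c x (T t), ENNReal.ofReal (K * (T t ^ d)⁻¹) *
            (ENNReal.ofReal (T t / t ^ 2) * ℓ X) ∂(Measure.pi fun _ : Fin (d + 2) => μ) := by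
          rw [lintegral_const_mul' _ _ ENNReal.ofReal_ne_top,
            lintegral_const_mul' _ _ ENNReal.ofReal_ne_top, mul_right_comm, ← mul_assoc,
            ← ENNReal.ofReal_mul (by positivity), ← ENNReal.ofReal_mul (by positivity)]
          congr 2
          field_simp
      _ ≤ ∫⁻ X in wideSimplices d c x (T t), u x t X * (w t X * ℓ X)
            ∂(Measure.pi fun _ : Fin (d + 2) => μ) := by
          refine setLIntegral_mono' hWm fun X hX => ?_
          have h0 : dist x (X 0) ≤ T t := by rw [dist_comm]; exact hX.1 0
          have h1 : ρ X ≤ 2 * t := by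
            have h2 := hX.1 (Fin.succ 0)
            have h3 := hX.1 (Fin.succ (Fin.last d))
            simp only [Metric.mem_closedBall] at h2 h3
            linarith [dist_triangle_right (X (Fin.succ 0)) (X (Fin.succ (Fin.last d))) x]
          have h4 : T t ≤ ρ X / c := (le_div_iff₀' hc0).2 hX.2
          have hu' : u x t X = ENNReal.ofReal (K * (T t ^ d)⁻¹) := Set.indicator_of_mem (by exact h0) _
          have hw' : w t X = ENNReal.ofReal (ρ X / (c * t ^ 2)) := Set.indicator_of_mem (by exact h1) _
          rw [hu', hw']
          rw [← div_div (ρ X)]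
          gcongr
      _ ≤ _ := lintegral_mono_set hsub
  refine (jonesFlatnessTilde_le_lintegral hr.le hpoint).trans ?_
  calc ∫⁻ x, ∫⁻ t in Set.Ioi (0 : ℝ), ∫⁻ X, u x t X * (w t X * ℓ X) ∂ν ∂volume ∂μ
      = ∫⁻ t in Set.Ioi (0 : ℝ), ∫⁻ x, ∫⁻ X, u x t X * (w t X * ℓ X) ∂ν ∂μ := by
        refine lintegral_lintegral_swap (Measurable.aemeasurable ?_)
        exact Measurable.lintegral_prod_right'
          (f := fun q : (H × ℝ) × (Fin (d + 2) → H) => u q.1.1 q.1.2 q.2 * (w q.1.2 q.2 * ℓ q.2))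
          (hF.comp (f := fun q : (H × ℝ) × (Fin (d + 2) → H) => (q.1.1, q.1.2, q.2)) (by fun_prop))
    _ = ∫⁻ t in Set.Ioi (0 : ℝ), ∫⁻ X, ∫⁻ x, u x t X * (w t X * ℓ X) ∂μ ∂ν := by
        refine lintegral_congr fun t => lintegral_lintegral_swap (Measurable.aemeasurable ?_)
        exact hF.comp (f := fun q : H × (Fin (d + 2) → H) => (q.1, t, q.2)) (by fun_prop)
    _ ≤ ∫⁻ t in Set.Ioi (0 : ℝ), ∫⁻ X, ENNReal.ofReal (K * C) * (w t X * ℓ X) ∂ν := by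
        refine setLIntegral_mono' measurableSet_Ioi fun t ht => lintegral_mono_ae ?_
        obtain ⟨hT0, hTt, hTD, hTs⟩ := hT t ht
        -- The upper mass bound at `x₀` requires `x₀` to be in the support.
        have hae : ∀ᵐ X ∂ν, X 0 ∈ μ.support :=
          ae_restrict_of_ae (Measure.tendsto_eval_ae_ae (μ := fun _ : Fin (d + 2) => μ) (i := 0)
            (Measure.support_mem_ae (μ := μ)))
        filter_upwards [hae] with X hX
        have hux : Measurable fun x => u x t X :=
          hu.comp (f := fun x => (x, t, X)) (by fun_prop)
        rw [lintegral_mul_const _ hux]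
        gcongr
        calc ∫⁻ x, u x t X ∂μ = ∫⁻ x, (Metric.closedBall (X 0) (T t)).indicator
              (fun _ => ENNReal.ofReal (K * (T t ^ d)⁻¹)) x ∂μ := rfl
          _ = ENNReal.ofReal (K * (T t ^ d)⁻¹) * μ (Metric.closedBall (X 0) (T t)) :=
            lintegral_indicator_const Metric.isClosed_closedBall.measurableSet _
          _ ≤ ENNReal.ofReal (K * (T t ^ d)⁻¹) * ENNReal.ofReal (C * T t ^ d) := by
            gcongr
            exact hμ.measure_le _ hX _ hT0 hTD
          _ = ENNReal.ofReal (K * C) := by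
            rw [← ENNReal.ofReal_mul (by positivity)]
            congr 1
            field_simp
    _ = ∫⁻ X, ∫⁻ t in Set.Ioi (0 : ℝ), ENNReal.ofReal (K * C) * (w t X * ℓ X) ∂volume ∂ν := by
        refine lintegral_lintegral_swap (Measurable.aemeasurable ?_)
        exact (hw.mul (hℓ.comp measurable_snd)).const_mul _
    _ ≤ ∫⁻ X, ENNReal.ofReal (K * C * (2 / c)) * ℓ X ∂ν := by
        refine lintegral_mono fun X => ?_
        have hwX : Measurable fun t => w t X := hw.comp (f := fun t => (t, X)) (by fun_prop)
        dsimp only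
        rw [lintegral_const_mul' _ _ ENNReal.ofReal_ne_top, lintegral_mul_const _ hwX, ← mul_assoc,
          ENNReal.ofReal_mul (p := K * C) (by positivity)]
        gcongr
        exact lintegral_Ioi_inv_sq_le dist_nonneg hc0
    _ = _ := lintegral_const_mul' _ _ ENNReal.ofReal_ne_top

end Hilbert

theorem proposition6p3 (d : ℕ) (hd : 1 ≤ d) (C : ℝ) (hC : 1 ≤ C) :
    ∃ C₉ : ℝ≥0,
      ∀ (H : Type*) [NormedAddCommGroup H] [InnerProductSpace ℝ H] [CompleteSpace H]
        [TopologicalSpace.SeparableSpace H] [MeasurableSpace H] [BorelSpace H],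
        (d : Cardinal) < Module.rank ℝ H →
        ∀ μ : Measure H, IsAhlforsRegular d C μ →
        ∀ (z : H) (r : ℝ), 0 < r →
          jonesFlatnessTilde d ((d : ℝ) + 1) μ (Metric.closedBall z (r / 3))
            ≤ (C₉ : ℝ≥0∞) * legerCurvatureMeasure d μ (Metric.closedBall z r) := by
  -- The choice `c = (12 C²)⁻¹` is the largest allowed by `12 C² c ≤ 1`.
  refine ⟨Real.toNNReal (C ^ (d + 2) * (2 / (12 * C ^ 2)⁻¹) ^ (d * (d + 1)) * C *
    (2 / (12 * C ^ 2)⁻¹)), ?_⟩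
  intro H _ _ _ _ _ _ hrank μ hμ z r hr
  have : SecondCountableTopology H := UniformSpace.secondCountable_of_separable H
  have h0 : 0 < 12 * C ^ 2 := by positivity
  exact jonesFlatnessTilde_le_legerCurvatureMeasure hd hrank.le hμ z hr (inv_pos.2 h0)
    (mul_inv_cancel₀ h0.ne').le
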